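/- Let $\Gamma$ be a finitely generated, virtually nilpotent group and let $S\subset\Gamma$ be a finite generating subset such that $1\in S$ or $S=S^{-1}$. Let $\pi$ be a unitary representation of $\Gamma$ on a complex Hilbert space $\mathcal H$ that has no finite subrepresentation, i.e. there is no nonzero closed $\pi(\Gamma)$-invariant subspace on which the action of $\Gamma$ factors through a finite group. Let $b:\Gamma\to\mathcal H$ be a 1-cocycle, i.e. $b(gh)=\pi(g)b(h)+b(g)$ for all $g,h\in\Gamma$, and let $\alpha(g)v=\pi(g)v+b(g)$ be the associated affine isometric action of $\Gamma$ on $\mathcal H$. For $n\in\mathbf N$ let $S^n$ be the set of products of $n$ elements of $S$, and put $$v_n=\frac{1}{|S^n|}\sum_{g\in S^n}b(g).$$ Then there is a subsequence $(v_{n_i})$ of $(v_n)$ which is a sequence of almost fixed points for $\alpha$, that is, $$\|\alpha(s)v_{n_i}-v_{n_i}\|\longrightarrow 0\quad\text{as } i\to\infty,\qquad\text{for every } s\in S.$$ (In particular, for an arbitrary finite generating subset $T$ of $\Gamma$ the result applies to the averages of $b$ over the balls $(T\cup\{1\})^n$ or $(T\cup T^{-1}\cup\{1\})^n$.) -/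

import Mathlib

open Filter Topology
open scoped Pointwise

/-- A unitary representation of a (discrete) group `G` on a complex Hilbert space `H`. -/
abbrev UnitaryRepresentation (G : Type*) [Group G] (H : Type*) [NormedAddCommGroup H]
    [InnerProductSpace ℂ H] : Type _ :=
  G →* (H ≃ₗᵢ[ℂ] H)

namespace UnitaryRepresentation

variable {G : Type*} [Group G] {H : Type*} [NormedAddCommGroup H] [InnerProductSpace ℂ H]

/-- `W` is (the space of) a subrepresentation of `π`: a closed linear subspace invariant under
`π`. -/
def IsSubrepresentation (π : UnitaryRepresentation G H) (W : Submodule ℂ H) : Prop :=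
  IsClosed (W : Set H) ∧ ∀ g : G, ∀ v ∈ W, π g v ∈ W

/-- The restriction of `π` to `W` factors through a finite group, namely through a quotient of `G`
by some normal subgroup `N` of finite index that acts trivially on `W`. -/
def IsFiniteOn (π : UnitaryRepresentation G H) (W : Submodule ℂ H) : Prop :=
  ∃ N : Subgroup G, N.Normal ∧ N.FiniteIndex ∧ ∀ g ∈ N, ∀ v ∈ W, π g v = v

/-- `π` has a nonzero finite subrepresentation. -/
def HasFiniteSubrepresentation (π : UnitaryRepresentation G H) : Prop :=
  ∃ W : Submodule ℂ H, W ≠ ⊥ ∧ π.IsSubrepresentation W ∧ π.IsFiniteOn W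

/-- `b` is a 1-cocycle for `π`. -/
def IsCocycle (π : UnitaryRepresentation G H) (b : G → H) : Prop :=
  ∀ g h : G, b (g * h) = π g (b h) + b g

/-- The affine action `α(g)v = π(g)v + b(g)` associated with `b`. -/
def affineAction (π : UnitaryRepresentation G H) (b : G → H) (g : G) (v : H) : H :=
  π g v + b g

/-- `v` is a sequence of almost fixed points for the affine action associated with `b`, with respect
to the finite set `S`. -/
def IsAlmostFixedSeq (π : UnitaryRepresentation G H) (b : G → H) (S : Finset G)
    (v : ℕ → H) : Prop :=
  ∀ s ∈ S, Tendsto (fun i => ‖π.affineAction b s (v i) - v i‖) atTop (𝓝 0)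

end UnitaryRepresentation

/-- The average `|S ^ n|⁻¹ ∑ b(g)` over `g` in `S ^ n`, the set of all products of `n` elements
of `S`. -/
noncomputable def powAverage {G : Type*} [Group G] [DecidableEq G] {H : Type*}
    [NormedAddCommGroup H] [InnerProductSpace ℂ H] (S : Finset G) (b : G → H) (n : ℕ) : H :=
  ((S ^ n).card : ℂ)⁻¹ • ∑ g ∈ S ^ n, b g

section PolynomialGrowth

variable {G : Type*} [Group G] [DecidableEq G]

theorem Finset.mem_pow_iff_exists_list {S : Finset G} {n : ℕ} {g : G} :
    g ∈ S ^ n ↔ ∃ l : List G, l.length = n ∧ (∀ x ∈ l, x ∈ S) ∧ l.prod = g := by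
  induction n generalizing g with
  | zero =>
    simp only [pow_zero, Finset.mem_one, List.length_eq_zero_iff]
    constructor
    · rintro rfl
      exact ⟨[], by simp⟩
    · rintro ⟨l, rfl, -, rfl⟩
      simp
  | succ n ih =>
    rw [pow_succ', Finset.mem_mul]
    constructor
    · rintro ⟨s, hs, h, hh, rfl⟩
      obtain ⟨l, hl, hlS, rfl⟩ := ih.1 hh
      refine ⟨s :: l, by simp [hl], ?_, by simp⟩
      simpa using ⟨hs, hlS⟩
    · rintro ⟨l, hl, hlS, rfl⟩
      cases l with
      | nil => simp at hl
      | cons s l =>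
        refine ⟨s, hlS s (by simp), l.prod, ih.2 ⟨l, by simpa using hl, ?_, rfl⟩, by simp⟩
        exact fun x hx => hlS x (by simp [hx])

/-- Conjugates of elements of a finite subset of a term of the lower central series by words of
length `n` have polynomial length over a suitable finite subset of the same term. -/
theorem exists_conj_mem_pow [Group.IsNilpotent G] (S : Finset G) (k : ℕ) (X : Finset G)
    (hX : ∀ x ∈ X, x ∈ (⊤ : Subgroup G).lowerCentralSeries k) :
    ∃ T : Finset G, (1 : G) ∈ T ∧ (∀ t ∈ T, t ∈ (⊤ : Subgroup G).lowerCentralSeries k) ∧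
      ∃ D : ℕ, ∀ n, ∀ x ∈ X, ∀ u ∈ S ^ n, u⁻¹ * x * u ∈ T ^ (n + 2) ^ D := by
  obtain ⟨c, hc⟩ := (Subgroup.nilpotent_iff_lowerCentralSeries (G := G)).1 inferInstance
  rcases le_total c k with hck | hkc
  · refine ⟨{1}, by simp, by simp [one_mem], 0, fun n x hx u _ => ?_⟩
    have : x ∈ (⊤ : Subgroup G).lowerCentralSeries c :=
      Subgroup.lowerCentralSeries_antitone _ hck (hX x hx)
    rw [hc, Subgroup.mem_bot] at this
    simp [this]
  induction hkc using Nat.decreasingInduction generalizing X with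
  | self =>
    refine ⟨{1}, by simp, by simp [one_mem], 0, fun n x hx u _ => ?_⟩
    have := hX x hx
    rw [hc, Subgroup.mem_bot] at this
    simp [this]
  | of_succ k hk ih =>
    obtain ⟨T, hT1, hTk, D, hD⟩ := ih (Finset.image₂ (fun x s => x⁻¹ * s⁻¹ * x * s) X S) (by
      intro y hy
      obtain ⟨x, hx, s, -, rfl⟩ := Finset.mem_image₂.1 hy
      rw [Subgroup.lowerCentralSeries_succ]
      have := Subgroup.commutator_mem_commutator (inv_mem (hX x hx))
        (Subgroup.mem_top s⁻¹)
      simpa [commutatorElement_def] using this)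
    have hTT : T ⊆ X ∪ T := Finset.subset_union_right
    have h1 : (1 : G) ∈ X ∪ T := hTT hT1
    refine ⟨X ∪ T, h1, ?_, D + 1, fun n x hx u hu => ?_⟩
    · intro t ht
      rcases Finset.mem_union.1 ht with h | h
      · exact hX t h
      · exact Subgroup.lowerCentralSeries_antitone _ (Nat.le_succ k) (hTk t h)
    · have key : ∀ m ≤ n, ∀ u ∈ S ^ m, u⁻¹ * x * u ∈ (X ∪ T) ^ (1 + m * (n + 2) ^ D) := by
        intro m
        induction m with
        | zero =>
          intro _ u hu
          rw [pow_zero, Finset.mem_one] at hu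
          subst hu
          simpa using Or.inl hx
        | succ m ihm =>
          intro hm u hu
          rw [pow_succ', Finset.mem_mul] at hu
          obtain ⟨s, hs, v, hv, rfl⟩ := hu
          have e : (s * v)⁻¹ * x * (s * v) =
              (v⁻¹ * x * v) * (v⁻¹ * (x⁻¹ * s⁻¹ * x * s) * v) := by group
          rw [e, show 1 + (m + 1) * (n + 2) ^ D = (1 + m * (n + 2) ^ D) + (n + 2) ^ D by ring,
            pow_add]
          refine Finset.mul_mem_mul (ihm (by omega) v hv) ?_
          refine Finset.pow_subset_pow hTT h1 ?_ (hD m _ (Finset.mem_image₂_of_mem hx hs) v hv)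
          exact Nat.pow_le_pow_left (by omega) _
      refine Finset.pow_subset_pow_right h1 ?_ (key n le_rfl u hu)
      have : 1 ≤ (n + 2) ^ D := Nat.one_le_pow _ _ (by omega)
      rw [pow_succ]
      nlinarith

/-- Moving a letter to the front of a word costs a bounded number of commutators per step. -/
theorem prod_append_cons_mem_mul {S T : Finset G} {n Q : ℕ}
    (hQ : ∀ m ≤ n, ∀ u ∈ S ^ m, ∀ s ∈ S, ∀ t ∈ S, u⁻¹ * (s⁻¹ * t⁻¹ * s * t) * u ∈ T ^ Q)
    {s : G} (hs : s ∈ S) (l₁ l₂ : List G) (h₁ : ∀ x ∈ l₁, x ∈ S) (h₂ : ∀ x ∈ l₂, x ∈ S)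
    (hn : l₁.length + l₂.length ≤ n) :
    ∃ w ∈ T ^ (l₁.length * Q), (l₁ ++ s :: l₂).prod = (s :: (l₁ ++ l₂)).prod * w := by
  induction l₁ using List.reverseRecOn generalizing l₂ with
  | nil => exact ⟨1, by simp, by simp⟩
  | append_singleton l t ih =>
    have ht : t ∈ S := h₁ t (by simp)
    obtain ⟨w, hw, e⟩ := ih (t :: l₂) (fun x hx => h₁ x (by simp [hx]))
      (by simpa using ⟨ht, h₂⟩) (by simp at hn ⊢; omega)
    refine ⟨w * (l₂.prod⁻¹ * (t⁻¹ * s⁻¹ * t * s) * l₂.prod), ?_, ?_⟩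
    · rw [List.length_append, List.length_singleton, add_mul, one_mul, pow_add]
      refine Finset.mul_mem_mul hw (hQ l₂.length ?_ _ ?_ t ht s hs)
      · simp at hn
        omega
      · exact Finset.mem_pow_iff_exists_list.2 ⟨l₂, rfl, h₂, rfl⟩
    · have e' : (s :: (l ++ [t] ++ l₂)).prod * (w * (l₂.prod⁻¹ * (t⁻¹ * s⁻¹ * t * s) * l₂.prod)) =
          (l ++ s :: t :: l₂).prod * (l₂.prod⁻¹ * (t⁻¹ * s⁻¹ * t * s) * l₂.prod) := by
        rw [e]
        simp [mul_assoc]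
      rw [e']
      simp only [List.prod_append, List.prod_cons, List.prod_nil]
      group

/-- Two words that differ by a permutation of their letters have products that differ by a short
product of commutators. -/
theorem List.Perm.exists_prod_eq_mul {S T : Finset G} {n Q : ℕ}
    (hQ : ∀ m ≤ n, ∀ u ∈ S ^ m, ∀ s ∈ S, ∀ t ∈ S, u⁻¹ * (s⁻¹ * t⁻¹ * s * t) * u ∈ T ^ Q)
    (h1 : (1 : G) ∈ T) {l l' : List G} (h : l.Perm l') (hl : ∀ x ∈ l, x ∈ S) (hn : l.length ≤ n) :
    ∃ w ∈ T ^ (l.length * (n * Q)), l'.prod = l.prod * w := by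
  induction l generalizing l' with
  | nil =>
    obtain rfl := h.nil_eq
    exact ⟨1, by simp, by simp⟩
  | cons s r ih =>
    obtain ⟨l₁, l₂, rfl⟩ := List.append_of_mem (h.subset (List.mem_cons_self))
    have hr : r.Perm (l₁ ++ l₂) :=
      (List.perm_cons s).1 (h.trans List.perm_middle)
    have hlen := hr.length_eq
    have hS : ∀ x ∈ l₁ ++ l₂, x ∈ S := fun x hx => hl x (List.mem_cons_of_mem _ (hr.symm.subset hx))
    simp only [List.length_cons, List.length_append] at hn hlen
    obtain ⟨w, hw, e⟩ := prod_append_cons_mem_mul hQ (hl s (by simp)) l₁ l₂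
      (fun x hx => hS x (by simp [hx])) (fun x hx => hS x (by simp [hx])) (by omega)
    obtain ⟨w', hw', e'⟩ := ih hr (fun x hx => hl x (by simp [hx])) (by omega)
    refine ⟨w' * w, ?_, ?_⟩
    · rw [List.length_cons, add_mul, one_mul, pow_add]
      refine Finset.mul_mem_mul hw' (Finset.pow_subset_pow_right h1 ?_ hw)
      exact Nat.mul_le_mul_right _ (by omega)
    · rw [e, List.prod_cons, e', List.prod_cons]
      group

theorem card_pow_le_mul_card_pow {S T : Finset G} {n Q : ℕ}
    (hQ : ∀ m ≤ n, ∀ u ∈ S ^ m, ∀ s ∈ S, ∀ t ∈ S, u⁻¹ * (s⁻¹ * t⁻¹ * s * t) * u ∈ T ^ Q)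
    (h1 : (1 : G) ∈ T) : (S ^ n).card ≤ (n + 1) ^ S.card * (T ^ (n * (n * Q))).card := by
  classical
  let p (f : S → Fin (n + 1)) (l : List G) : Prop :=
    l.length = n ∧ (∀ x ∈ l, x ∈ S) ∧ ∀ s : S, l.count (s : G) = f s
  let c (f : S → Fin (n + 1)) : G := if h : ∃ l, p f l then h.choose.prod else 1
  have hsub : S ^ n ⊆ (Finset.univ : Finset (S → Fin (n + 1))).biUnion
      (fun f => (T ^ (n * (n * Q))).image (fun w => c f * w)) := by
    intro g hg
    obtain ⟨l, hl, hlS, rfl⟩ := Finset.mem_pow_iff_exists_list.1 hg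
    let f : S → Fin (n + 1) := fun s =>
      ⟨l.count (s : G), Nat.lt_succ_of_le (hl ▸ List.count_le_length)⟩
    have hex : ∃ l, p f l := ⟨l, hl, hlS, fun s => rfl⟩
    obtain ⟨h₁, h₂, h₃⟩ := hex.choose_spec
    have hperm : hex.choose.Perm l := by
      rw [List.perm_iff_count]
      intro a
      by_cases ha : a ∈ S
      · exact h₃ ⟨a, ha⟩
      · rw [List.count_eq_zero_of_not_mem (fun h => ha (h₂ a h)),
          List.count_eq_zero_of_not_mem (fun h => ha (hlS a h))]
    obtain ⟨w, hw, e⟩ := hperm.exists_prod_eq_mul hQ h1 h₂ h₁.le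
    rw [h₁] at hw
    refine Finset.mem_biUnion.2 ⟨f, Finset.mem_univ _, Finset.mem_image.2 ⟨w, hw, ?_⟩⟩
    simp only [c, dif_pos hex, e]
  calc (S ^ n).card ≤ _ := Finset.card_le_card hsub
    _ ≤ (Finset.univ : Finset (S → Fin (n + 1))).card * (T ^ (n * (n * Q))).card :=
      Finset.card_biUnion_le_card_mul _ _ _ (fun f _ => Finset.card_image_le)
    _ = _ := by simp

theorem exists_card_pow_le_of_subset_lowerCentralSeries [Group.IsNilpotent G] (k : ℕ)
    (S : Finset G) (hS : ∀ s ∈ S, s ∈ (⊤ : Subgroup G).lowerCentralSeries k) :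
    ∃ D : ℕ, ∀ n, (S ^ n).card ≤ (n + 2) ^ D := by
  obtain ⟨c, hc⟩ := (Subgroup.nilpotent_iff_lowerCentralSeries (G := G)).1 inferInstance
  have htriv : ∀ S : Finset G, (∀ s ∈ S, s ∈ (⊤ : Subgroup G).lowerCentralSeries c) →
      ∃ D : ℕ, ∀ n, (S ^ n).card ≤ (n + 2) ^ D := by
    intro S hS
    refine ⟨0, fun n => ?_⟩
    have : S ⊆ {1} := fun s hs => by
      have := hS s hs
      rw [hc, Subgroup.mem_bot] at this
      simp [this]
    simpa using Finset.card_le_card (Finset.pow_subset_pow_left (n := n) this)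
  rcases le_total c k with hck | hkc
  · exact htriv S fun s hs => Subgroup.lowerCentralSeries_antitone _ hck (hS s hs)
  induction hkc using Nat.decreasingInduction generalizing S with
  | self => exact htriv S hS
  | of_succ k hk ih =>
    obtain ⟨T, hT1, hTk, D, hD⟩ := exists_conj_mem_pow S (k + 1)
      (Finset.image₂ (fun s t => s⁻¹ * t⁻¹ * s * t) S S) (by
      intro y hy
      obtain ⟨x, hx, s, -, rfl⟩ := Finset.mem_image₂.1 hy
      rw [Subgroup.lowerCentralSeries_succ]
      have := Subgroup.commutator_mem_commutator (inv_mem (hS x hx))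
        (Subgroup.mem_top s⁻¹)
      simpa [commutatorElement_def] using this)
    obtain ⟨E, hE⟩ := ih T hTk
    refine ⟨S.card + (D + 3) * E, fun n => ?_⟩
    have h := card_pow_le_mul_card_pow (S := S) (T := T) (n := n) (Q := (n + 2) ^ D)
      (fun m hm u hu s hs t ht => Finset.pow_subset_pow_right hT1
        (Nat.pow_le_pow_left (by omega) _) (hD m _ (Finset.mem_image₂_of_mem hs ht) u hu)) hT1
    refine h.trans ?_
    rw [pow_add, pow_mul (n + 2) (D + 3) E]
    refine Nat.mul_le_mul (Nat.pow_le_pow_left (by omega) _) ((hE _).trans ?_)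
    refine Nat.pow_le_pow_left ?_ _
    have : 1 ≤ (n + 2) ^ D := Nat.one_le_pow _ _ (by omega)
    calc n * (n * (n + 2) ^ D) + 2 ≤ n * (n * (n + 2) ^ D) + 2 * (n + 2) ^ D := by omega
      _ = (n * n + 2) * (n + 2) ^ D := by ring
      _ ≤ (n + 2) ^ 3 * (n + 2) ^ D := Nat.mul_le_mul_right _ (by nlinarith)
      _ = (n + 2) ^ (D + 3) := by ring

/-- Finite subsets of a nilpotent group have polynomial growth. -/
theorem Group.IsNilpotent.exists_card_pow_le [Group.IsNilpotent G] (S : Finset G) :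
    ∃ D : ℕ, ∀ n, (S ^ n).card ≤ (n + 2) ^ D :=
  exists_card_pow_le_of_subset_lowerCentralSeries 0 S (by simp)

/-- Schreier rewriting: words in a finite set `S` are words of the same length in a finite subset
of a given subgroup of finite index, up to finitely many coset representatives. -/
theorem Subgroup.exists_finset_pow_mul_of_finiteIndex (N : Subgroup G) [N.FiniteIndex]
    (S : Finset G) :
    ∃ (T : Finset N) (R : Finset G), ∀ n, ∀ g ∈ S ^ n, ∃ t ∈ T ^ n, ∃ r ∈ R, g = t * r := by
  classical
  have : Fintype (G ⧸ N) := Fintype.ofFinite _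
  let ρ : G → G := fun g => (((g⁻¹ : G) : G ⧸ N).out)⁻¹
  have hρ : ∀ g, g * (ρ g)⁻¹ ∈ N := by
    intro g
    obtain ⟨h, hh⟩ := QuotientGroup.mk_out_eq_mul N g⁻¹
    simp only [ρ, inv_inv, hh]
    simp
  let R : Finset G := insert 1 (Finset.univ.image (fun q : G ⧸ N => q.out⁻¹))
  have hR : ∀ g, ρ g ∈ R := fun g => by simp [R, ρ]
  refine ⟨Finset.image₂ (fun r s => ⟨r * s * (ρ (r * s))⁻¹, hρ _⟩) R S, R, fun n => ?_⟩
  induction n with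
  | zero =>
    intro g hg
    exact ⟨1, by simp, 1, by simp [R], by simpa using hg⟩
  | succ n ih =>
    intro g hg
    rw [pow_succ, Finset.mem_mul] at hg
    obtain ⟨h, hh, s, hs, rfl⟩ := hg
    obtain ⟨t, ht, r, hr, rfl⟩ := ih h hh
    refine ⟨t * ⟨r * s * (ρ (r * s))⁻¹, hρ _⟩, ?_, ρ (r * s), hR _, by simp [mul_assoc]⟩
    rw [pow_succ]
    exact Finset.mul_mem_mul ht (Finset.mem_image₂_of_mem hr hs)

/-- Finite subsets of a virtually nilpotent group have polynomial growth. -/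
theorem Group.IsVirtuallyNilpotent.exists_card_pow_le (hG : Group.IsVirtuallyNilpotent G)
    (S : Finset G) : ∃ C D : ℕ, ∀ n, (S ^ n).card ≤ C * (n + 2) ^ D := by
  obtain ⟨N, hN, hfin⟩ := hG
  obtain ⟨T, R, h⟩ := N.exists_finset_pow_mul_of_finiteIndex S
  obtain ⟨D, hD⟩ := Group.IsNilpotent.exists_card_pow_le T
  refine ⟨R.card, D, fun n => ?_⟩
  have hsub : S ^ n ⊆ Finset.image₂ (fun (t : N) r => (t : G) * r) (T ^ n) R := by
    intro g hg
    obtain ⟨t, ht, r, hr, rfl⟩ := h n g hg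
    exact Finset.mem_image₂_of_mem ht hr
  calc (S ^ n).card ≤ _ := Finset.card_le_card hsub
    _ ≤ (T ^ n).card * R.card := Finset.card_image₂_le _ _ _
    _ ≤ (n + 2) ^ D * R.card := Nat.mul_le_mul_right _ (hD n)
    _ = _ := mul_comm _ _

end PolynomialGrowth

namespace UnitaryRepresentation

variable {G : Type*} [Group G] {H : Type*} [NormedAddCommGroup H] [InnerProductSpace ℂ H]
  {π : UnitaryRepresentation G H} {b : G → H}

theorem IsCocycle.map_one (hb : π.IsCocycle b) : b 1 = 0 := by
  simpa using hb 1 1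

theorem IsCocycle.map_inv (hb : π.IsCocycle b) (g : G) : b g⁻¹ = -π g⁻¹ (b g) := by
  have h := hb g⁻¹ g
  rw [inv_mul_cancel, hb.map_one] at h
  exact (neg_eq_of_add_eq_zero_right h.symm).symm

theorem map_mul_apply (g h : G) (v : H) : π (g * h) v = π g (π h v) := by
  rw [map_mul]; rfl

theorem map_inv_apply_self (g : G) (v : H) : π g⁻¹ (π g v) = v := by
  rw [← map_mul_apply, inv_mul_cancel, map_one]; rfl

theorem map_apply_inv_self (g : G) (v : H) : π g (π g⁻¹ v) = v := by
  rw [← map_mul_apply, mul_inv_cancel, map_one]; rfl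

theorem inner_map_left (g : G) (v w : H) : inner ℂ (π g v) w = inner ℂ v (π g⁻¹ w) := by
  rw [← (π g).inner_map_map v, map_apply_inv_self]

/-- The stabilizer of a vector. -/
def vectorStabilizer (π : UnitaryRepresentation G H) (v : H) : Subgroup G where
  carrier := {g | π g v = v}
  one_mem' := by simp
  mul_mem' {g h} hg hh := by
    simp only [Set.mem_ofPred_eq] at *
    rw [map_mul_apply, hh, hg]
  inv_mem' {g} hg := by
    simp only [Set.mem_ofPred_eq] at *
    nth_rw 1 [← hg]
    exact map_inv_apply_self g v

@[simp]
theorem mem_vectorStabilizer {g : G} {v : H} : g ∈ π.vectorStabilizer v ↔ π g v = v := Iff.rfl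

/-- Without finite subrepresentations, no nonzero vector has a stabilizer of finite index. -/
theorem eq_zero_of_finiteIndex_vectorStabilizer (hπ : ¬ π.HasFiniteSubrepresentation) {v : H}
    (hv : (π.vectorStabilizer v).FiniteIndex) : v = 0 := by
  by_contra hne
  apply hπ
  let M := (π.vectorStabilizer v).normalCore
  let W : Submodule ℂ H :=
    { carrier := {w | ∀ g ∈ M, π g w = w}
      add_mem' := fun ha hb g hg => by rw [map_add, ha g hg, hb g hg]
      zero_mem' := fun g _ => map_zero _
      smul_mem' := fun c w hw g hg => by rw [map_smul, hw g hg] }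
  have hvW : v ∈ W := fun g hg => (π.vectorStabilizer v).normalCore_le hg
  refine ⟨W, ?_, ⟨?_, ?_⟩, M, Subgroup.normalCore_normal _, inferInstance, fun g hg w hw => hw g hg⟩
  · rintro h
    rw [h, Submodule.mem_bot] at hvW
    exact hne hvW
  · have : (W : Set H) = ⋂ g ∈ M, {w | π g w = w} := by
      ext w
      simp [W]
    rw [this]
    exact isClosed_biInter fun g _ => isClosed_eq (π g).continuous continuous_id
  · intro g w hw m hm
    have : π (g⁻¹ * m * g) w = w := hw _ (by
      have := (Subgroup.normalCore_normal (π.vectorStabilizer v)).conj_mem m hm g⁻¹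
      simpa using this)
    rw [mul_assoc, map_mul_apply, map_mul_apply] at this
    rw [← map_apply_inv_self (π := π) g (π m (π g w)), this]

/-- A cocycle for a nilpotent group which vanishes on a term of the upper central series, takes
values in the vectors fixed by it, and is orthogonal to all coboundaries, vanishes on the next term
and takes values in the vectors fixed by that. -/
theorem IsCocycle.fixed_upperCentralSeries_succ (hb : π.IsCocycle b) {T : Finset G}
    (hT : Subgroup.closure (T : Set G) = ⊤) (hfix : ∀ v, (∀ g, π g v = v) → v = 0)
    (hharm : ∀ v, ∑ t ∈ T, inner ℂ (b t) (v - π t v) = 0) {k : ℕ}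
    (hk : ∀ z ∈ Subgroup.upperCentralSeries G k, b z = 0 ∧ ∀ g, π z (b g) = b g) :
    ∀ z ∈ Subgroup.upperCentralSeries G (k + 1), b z = 0 ∧ ∀ g, π z (b g) = b g := by
  intro z hz
  rw [Subgroup.mem_upperCentralSeries_succ_iff] at hz
  have hrel : ∀ g, π z (b g) - b g = π g (b z) - b z := by
    intro g
    have hc := hk _ (hz g)
    rw [commutatorElement_def] at hc
    have e : z * g = (z * g * z⁻¹ * g⁻¹) * (g * z) := by group
    have h1 := hb z g
    rw [e, hb, hc.1, hc.2, hb, add_zero] at h1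
    rw [sub_eq_sub_iff_add_eq_add]
    exact h1.symm
  have hcomm : ∀ t v, inner ℂ (b t) (π (z⁻¹ * t) v) = inner ℂ (b t) (π (t * z⁻¹) v) := by
    intro t v
    have hmem : (z⁻¹ * t * z * t⁻¹) ∈ Subgroup.upperCentralSeries G k := by
      have h2 : z⁻¹ ∈ Subgroup.upperCentralSeries G (k + 1) :=
        inv_mem (Subgroup.mem_upperCentralSeries_succ_iff.2 hz)
      simpa [commutatorElement_def] using Subgroup.mem_upperCentralSeries_succ_iff.1 h2 t
    have hc := (hk _ hmem).2
    have e : z⁻¹ * t = (z⁻¹ * t * z * t⁻¹) * (t * z⁻¹) := by group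
    rw [e, map_mul_apply]
    nth_rw 1 [← hc t]
    exact (π _).inner_map_map _ _
  have hd : ∑ t ∈ T, inner ℂ (π z (b t) - b t) (π z (b t) - b t) = 0 := by
    have h1 : ∀ t, inner ℂ (π z (b t) - b t) (π z (b t) - b t) =
        inner ℂ (b t) (b z - π t (b z)) -
          inner ℂ (b t) (π z⁻¹ (b z) - π t (π z⁻¹ (b z))) := by
      intro t
      nth_rw 2 [hrel t]
      rw [inner_sub_left, inner_map_left, map_sub, ← map_mul_apply, inner_sub_right (b t) (π (z⁻¹ * t) _),
        hcomm, map_mul_apply]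
      simp only [inner_sub_right]
      ring
    simp only [h1, Finset.sum_sub_distrib, hharm, sub_zero]
  have hdt : ∀ t ∈ T, π z (b t) - b t = 0 := by
    intro t ht
    have h2 : ∑ t ∈ T, ‖π z (b t) - b t‖ ^ 2 = 0 := by
      have := congrArg Complex.re hd
      rw [Complex.re_sum] at this
      simp only [inner_self_eq_norm_sq_to_K] at this
      norm_cast at this
    have h3 := (Finset.sum_eq_zero_iff_of_nonneg (fun _ _ => by positivity)).1 h2 t ht
    simpa using h3
  have hbz : b z = 0 := by
    refine hfix _ fun g => ?_
    have : Subgroup.closure (T : Set G) ≤ π.vectorStabilizer (b z) := by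
      rw [Subgroup.closure_le]
      intro t ht
      have := hrel t
      rw [hdt t ht] at this
      exact (sub_eq_zero.1 this.symm)
    exact this (hT ▸ Subgroup.mem_top g)
  refine ⟨hbz, fun g => ?_⟩
  have := hrel g
  rwa [hbz, map_zero, sub_zero, sub_eq_zero] at this

/-- A cocycle of a nilpotent group orthogonal to all coboundaries vanishes, if there are no nonzero
invariant vectors. -/
theorem IsCocycle.eq_zero_of_orthogonal_coboundaries [Group.IsNilpotent G] (hb : π.IsCocycle b)
    {T : Finset G} (hT : Subgroup.closure (T : Set G) = ⊤)
    (hfix : ∀ v, (∀ g, π g v = v) → v = 0)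
    (hharm : ∀ v, ∑ t ∈ T, inner ℂ (b t) (v - π t v) = 0) (g : G) : b g = 0 := by
  have key : ∀ k, ∀ z ∈ Subgroup.upperCentralSeries G k, b z = 0 ∧ ∀ g, π z (b g) = b g := by
    intro k
    induction k with
    | zero =>
      intro z hz
      rw [Subgroup.upperCentralSeries_zero, Subgroup.mem_bot] at hz
      subst hz
      exact ⟨hb.map_one, fun g => by simp⟩
    | succ k ih => exact hb.fixed_upperCentralSeries_succ hT hfix hharm ih
  obtain ⟨c, hc⟩ := Group.IsNilpotent.nilpotent G
  exact (key c g (hc ▸ Subgroup.mem_top g)).1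

theorem isCocycle_coboundary (v : H) : π.IsCocycle fun g => v - π g v := by
  intro g h
  simp only [map_mul_apply, map_sub]
  abel

/-- Cocycles that converge on a generating set converge everywhere to a cocycle. -/
theorem exists_isCocycle_of_tendsto {T : Set G} (hT : Subgroup.closure T = ⊤) {c : ℕ → G → H}
    (hc : ∀ n, π.IsCocycle (c n)) {p : G → H}
    (hp : ∀ t ∈ T, Tendsto (fun n => c n t) atTop (𝓝 (p t))) :
    ∃ q : G → H, π.IsCocycle q ∧ ∀ t ∈ T, q t = p t := by
  have h : ∀ g, ∃ y, Tendsto (fun n => c n g) atTop (𝓝 y) := by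
    intro g
    have hg : g ∈ Subgroup.closure T := hT ▸ Subgroup.mem_top g
    induction hg using Subgroup.closure_induction with
    | mem t ht => exact ⟨p t, hp t ht⟩
    | one => exact ⟨0, by simp [fun n => (hc n).map_one]⟩
    | mul g h _ _ ihg ihh =>
      obtain ⟨y, hy⟩ := ihg
      obtain ⟨y', hy'⟩ := ihh
      refine ⟨π g y' + y, ?_⟩
      simp only [(hc _) g h]
      exact (((π g).continuous.tendsto _).comp hy').add hy
    | inv g _ ih =>
      obtain ⟨y, hy⟩ := ih
      refine ⟨-π g⁻¹ y, ?_⟩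
      simp only [(hc _).map_inv]
      exact (((π g⁻¹).continuous.tendsto _).comp hy).neg
  choose q hq using h
  refine ⟨q, fun g h => ?_, fun t ht => tendsto_nhds_unique (hq t) (hp t ht)⟩
  refine tendsto_nhds_unique (hq (g * h)) ?_
  simp only [(hc _) g h]
  exact (((π g).continuous.tendsto _).comp (hq h)).add (hq g)

/-- For a nilpotent group and a unitary representation without nonzero invariant vectors, every
cocycle is a limit of coboundaries. -/
theorem IsCocycle.exists_coboundary_approx [CompleteSpace H] [Group.IsNilpotent G]
    (hb : π.IsCocycle b) {T : Finset G} (hT : Subgroup.closure (T : Set G) = ⊤)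
    (hfix : ∀ v, (∀ g, π g v = v) → v = 0) {ε : ℝ} (hε : 0 < ε) :
    ∃ v : H, ∀ t ∈ T, ‖b t - (v - π t v)‖ ≤ ε := by
  let K := PiLp 2 (fun _ : T => H)
  let d : H →ₗ[ℂ] K :=
    { toFun := fun v => WithLp.toLp 2 fun t => v - π t v
      map_add' := fun v w => by
        ext t
        change v + w - π t (v + w) = (v - π t v) + (w - π t w)
        rw [map_add]
        abel
      map_smul' := fun c v => by
        ext t
        change c • v - π t (c • v) = c • (v - π t v)
        rw [map_smul, smul_sub] }
  let D : Submodule ℂ K := (LinearMap.range d).topologicalClosure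
  have : CompleteSpace D := (LinearMap.range d).isClosed_topologicalClosure.completeSpace_coe
  let β : K := WithLp.toLp 2 fun t => b t
  let p : K := D.starProjection β
  have hpD : p ∈ closure (LinearMap.range d : Set K) := D.starProjection_apply_mem β
  obtain ⟨x, hx, hxp⟩ := mem_closure_iff_seq_limit.1 hpD
  choose u hu using hx
  classical
  have hconv : ∀ t : T, Tendsto (fun n => u n - π t (u n)) atTop (𝓝 (p t)) := by
    intro t
    have h1 : Continuous fun y : K => y t := PiLp.continuous_apply 2 _ t
    have h2 := (h1.tendsto p).comp hxp
    refine h2.congr fun n => ?_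
    rw [Function.comp_apply, ← hu n]
    rfl
  obtain ⟨q, hq, hqp⟩ := exists_isCocycle_of_tendsto (T := (T : Set G)) (π := π) hT
    (fun n => isCocycle_coboundary (u n))
    (p := fun g => if h : g ∈ T then p ⟨g, h⟩ else 0) (fun t ht => by
      have ht' : t ∈ T := ht
      simp only [dif_pos ht']
      exact hconv ⟨t, ht'⟩)
  have hqp' : ∀ t : T, q t = p t := fun t => by
    have := hqp t t.2
    simpa using this
  have hbq : π.IsCocycle fun g => b g - q g := by
    intro g h
    simp only [hb g h, hq g h, map_sub]
    abel
  have hzero : ∀ g, b g - q g = 0 := by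
    refine hbq.eq_zero_of_orthogonal_coboundaries hT hfix fun v => ?_
    have h1 : inner ℂ (β - p) (d v) = 0 :=
      D.starProjection_inner_eq_zero β (d v)
        ((LinearMap.range d).le_topologicalClosure (LinearMap.mem_range_self d v))
    rw [PiLp.inner_apply] at h1
    rw [← Finset.sum_coe_sort, ← h1]
    refine Finset.sum_congr rfl fun t _ => ?_
    rw [hqp' t]
    rfl
  have hall : ∀ᶠ n in atTop, ∀ t : T, ‖b t - (u n - π t (u n))‖ < ε := by
    rw [eventually_all]
    intro t
    have h1 := hconv t
    rw [← hqp' t, ← sub_eq_zero.1 (hzero t)] at h1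
    have h2 := (tendsto_const_nhds.sub h1).norm (a := b t - b t) (f := fun n => b t - (u n - π t (u n)))
    rw [sub_self, norm_zero] at h2
    exact h2.eventually (gt_mem_nhds hε)
  obtain ⟨n, hn⟩ := hall.exists
  exact ⟨u n, fun t ht => (hn ⟨t, ht⟩).le⟩

theorem IsCocycle.norm_sub_coboundary_le (hb : π.IsCocycle b) [DecidableEq G] {T : Finset G}
    {v : H} {ε : ℝ} (hv : ∀ t ∈ T, ‖b t - (v - π t v)‖ ≤ ε) {n : ℕ} {g : G} (hg : g ∈ T ^ n) :
    ‖b g - (v - π g v)‖ ≤ n * ε := by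
  induction n generalizing g with
  | zero =>
    rw [pow_zero, Finset.mem_one] at hg
    subst hg
    simp [hb.map_one]
  | succ n ih =>
    rw [pow_succ', Finset.mem_mul] at hg
    obtain ⟨s, hs, h, hh, rfl⟩ := hg
    have e : b (s * h) - (v - π (s * h) v) = π s (b h - (v - π h v)) + (b s - (v - π s v)) := by
      rw [hb, map_mul_apply]
      simp only [map_sub]
      abel
    rw [e]
    refine (norm_add_le _ _).trans ?_
    rw [LinearIsometryEquiv.norm_map]
    push_cast
    linarith [ih hh, hv s hs]

/-- Cocycles of virtually nilpotent groups grow sublinearly, if the representation has no finite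
subrepresentation. -/
theorem IsCocycle.sublinear [CompleteSpace H] [DecidableEq G]
    (hG : Group.IsVirtuallyNilpotent G) (S : Finset G)
    (hgen : Subgroup.closure (S : Set G) = ⊤) (hπ : ¬ π.HasFiniteSubrepresentation)
    (hb : π.IsCocycle b) {ε : ℝ} (hε : 0 < ε) :
    ∃ M : ℝ, 0 ≤ M ∧ ∀ n : ℕ, ∀ g ∈ S ^ n, ‖b g‖ ≤ ε * n + M := by
  obtain ⟨N, hN, hfin⟩ := hG
  obtain ⟨T, R, hTR⟩ := N.exists_finset_pow_mul_of_finiteIndex S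
  obtain ⟨T', -, hT'⟩ := N.exists_finset_card_le_mul hgen
  let π' : UnitaryRepresentation N H := π.comp N.subtype
  have hb' : π'.IsCocycle fun g => b g := fun g h => hb g h
  have hfix : ∀ v, (∀ g, π' g v = v) → v = 0 := fun v hv =>
    eq_zero_of_finiteIndex_vectorStabilizer hπ
      (Subgroup.finiteIndex_of_le (H := N) fun g hg => hv ⟨g, hg⟩)
  have hT'' : Subgroup.closure ((T ∪ T' : Finset N) : Set N) = ⊤ := by
    rw [Finset.coe_union, Subgroup.closure_union, hT', sup_top_eq]
  obtain ⟨v, hv⟩ := hb'.exists_coboundary_approx hT'' hfix hε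
  refine ⟨2 * ‖v‖ + ∑ r ∈ R, ‖b r‖, by positivity, fun n g hg => ?_⟩
  obtain ⟨t, ht, r, hr, rfl⟩ := hTR n g hg
  have h1 : ‖b t - (v - π t v)‖ ≤ n * ε := hb'.norm_sub_coboundary_le hv
    (Finset.pow_subset_pow_left Finset.subset_union_left ht)
  have h2 : ‖v - π t v‖ ≤ 2 * ‖v‖ := by
    refine (norm_sub_le _ _).trans ?_
    rw [LinearIsometryEquiv.norm_map]
    linarith
  have h3 : ‖b r‖ ≤ ∑ r ∈ R, ‖b r‖ :=
    Finset.single_le_sum (f := fun r => ‖b r‖) (fun _ _ => norm_nonneg _) hr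
  have h4 : ‖b t‖ ≤ ‖b t - (v - π t v)‖ + ‖v - π t v‖ := by
    simpa using norm_add_le (b t - (v - π t v)) (v - π t v)
  have h5 : ‖b (t * r)‖ ≤ ‖b r‖ + ‖b t‖ := by
    rw [hb]
    refine (norm_add_le _ _).trans ?_
    rw [LinearIsometryEquiv.norm_map]
  linarith

end UnitaryRepresentation

theorem norm_average_sub_average_le {α E : Type*} [NormedAddCommGroup E] [NormedSpace ℂ E]
    {X Y : Finset α} (hXY : X ⊆ Y) (hX : X.Nonempty) {f : α → E} {M : ℝ}
    (hf : ∀ y ∈ Y, ‖f y‖ ≤ M) :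
    ‖(X.card : ℂ)⁻¹ • ∑ x ∈ X, f x - (Y.card : ℂ)⁻¹ • ∑ y ∈ Y, f y‖ ≤
      2 * (((Y.card : ℝ) - X.card) / X.card) * M := by
  classical
  have hx : (0 : ℝ) < X.card := by exact_mod_cast hX.card_pos
  have hxy : (X.card : ℝ) ≤ Y.card := by exact_mod_cast Finset.card_le_card hXY
  have hy : (0 : ℝ) < Y.card := hx.trans_le hxy
  have hM : 0 ≤ M := by
    obtain ⟨x, hx⟩ := hX
    exact (norm_nonneg _).trans (hf x (hXY hx))
  have e : (X.card : ℂ)⁻¹ • ∑ x ∈ X, f x - (Y.card : ℂ)⁻¹ • ∑ y ∈ Y, f y =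
      (((X.card : ℝ)⁻¹ - (Y.card : ℝ)⁻¹ : ℝ) : ℂ) • ∑ x ∈ X, f x -
        (Y.card : ℂ)⁻¹ • ∑ y ∈ Y \ X, f y := by
    rw [← Finset.sum_sdiff hXY]
    push_cast
    module
  have h1 : ‖∑ x ∈ X, f x‖ ≤ X.card * M := by
    simpa using norm_sum_le_of_le X fun x hx => hf x (hXY hx)
  have h2 : ‖∑ y ∈ Y \ X, f y‖ ≤ ((Y.card : ℝ) - X.card) * M := by
    have := norm_sum_le_of_le (Y \ X) fun x hx => hf x (Finset.mem_sdiff.1 hx).1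
    rw [Finset.sum_const, Finset.card_sdiff_of_subset hXY, nsmul_eq_mul,
      Nat.cast_sub (Finset.card_le_card hXY)] at this
    exact this
  have h3 : (0 : ℝ) ≤ (X.card : ℝ)⁻¹ - (Y.card : ℝ)⁻¹ := sub_nonneg.2 (inv_anti₀ hx hxy)
  rw [e]
  refine (norm_sub_le _ _).trans ?_
  rw [norm_smul, norm_smul, Complex.norm_real, Real.norm_of_nonneg h3, norm_inv, Complex.norm_natCast]
  calc _ ≤ ((X.card : ℝ)⁻¹ - (Y.card : ℝ)⁻¹) * (X.card * M) +
        (Y.card : ℝ)⁻¹ * (((Y.card : ℝ) - X.card) * M) := by gcongr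
    _ = 2 * (((Y.card : ℝ) - X.card) / Y.card) * M := by
      field_simp
      ring
    _ ≤ _ := by
      have : 0 ≤ (Y.card : ℝ) - X.card := sub_nonneg.2 hxy
      gcongr

theorem one_add_pow_le_one_add_three_pow_mul {y : ℝ} (h0 : 0 ≤ y) (h1 : y ≤ 1) (m : ℕ) :
    (1 + y) ^ m ≤ 1 + 3 ^ m * y := by
  induction m with
  | zero => simpa using h0
  | succ m ih =>
    have h3 : (1 : ℝ) ≤ 3 ^ m := one_le_pow₀ (by norm_num)
    calc (1 + y) ^ (m + 1) ≤ (1 + 3 ^ m * y) * (1 + y) := by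
          rw [pow_succ]
          gcongr
      _ = 1 + (y + 3 ^ m * y + 3 ^ m * y * y) := by ring
      _ ≤ 1 + (3 ^ m * y + 3 ^ m * y + 3 ^ m * y * 1) := by
          gcongr
          nlinarith
      _ = _ := by ring

/-- A sequence of polynomial growth has small relative increments infinitely often. -/
theorem frequently_mul_sub_le_of_le_mul_pow {a : ℕ → ℝ} (ha : ∀ n, 0 < a n) {C : ℝ} {D : ℕ}
    (h : ∀ n : ℕ, a n ≤ C * ((n : ℝ) + 2) ^ D) :
    ∃ K : ℝ, 0 ≤ K ∧ ∃ᶠ n : ℕ in atTop, ((n : ℝ) + 2) * (a (n + 2) - a n) ≤ K * a n := by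
  refine ⟨2 * 3 ^ (D + 1), by positivity, fun hev => ?_⟩
  obtain ⟨n₀, hn₀⟩ := eventually_atTop.1 hev
  have hstep : ∀ n ≥ n₀, a n * ((n : ℝ) + 4) ^ (D + 1) ≤ a (n + 2) * ((n : ℝ) + 2) ^ (D + 1) := by
    intro n hn
    have h1 := not_le.1 (hn₀ n hn)
    have hx : (0 : ℝ) < (n : ℝ) + 2 := by positivity
    have h2 := one_add_pow_le_one_add_three_pow_mul (y := 2 / ((n : ℝ) + 2)) (by positivity)
      (by rw [div_le_one hx]; linarith [n.cast_nonneg (α := ℝ)]) (D + 1)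
    have h3 : ((n : ℝ) + 4) = (1 + 2 / ((n : ℝ) + 2)) * ((n : ℝ) + 2) := by
      field_simp
      ring
    have h4 : a n * (1 + 3 ^ (D + 1) * (2 / ((n : ℝ) + 2))) ≤ a (n + 2) := by
      have : a n * (1 + 3 ^ (D + 1) * (2 / ((n : ℝ) + 2))) =
          (((n : ℝ) + 2) * a n + 2 * 3 ^ (D + 1) * a n) / ((n : ℝ) + 2) := by
        field_simp
      rw [this, div_le_iff₀ hx]
      linarith
    rw [h3, mul_pow, ← mul_assoc]
    gcongr
    exact (mul_le_mul_of_nonneg_left h2 (ha n).le).trans h4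
  have hind : ∀ m : ℕ, a n₀ * ((n₀ + 2 * m : ℕ) + 2 : ℝ) ^ (D + 1) ≤
      a (n₀ + 2 * m) * ((n₀ : ℝ) + 2) ^ (D + 1) := by
    intro m
    induction m with
    | zero => simp
    | succ m ih =>
      have h1 := hstep (n₀ + 2 * m) (by omega)
      have hx : (0 : ℝ) < ((n₀ + 2 * m : ℕ) + 2 : ℝ) ^ (D + 1) := by positivity
      have e : ((n₀ + 2 * (m + 1) : ℕ) + 2 : ℝ) = ((n₀ + 2 * m : ℕ) : ℝ) + 4 := by
        push_cast
        ring
      rw [e, show n₀ + 2 * (m + 1) = n₀ + 2 * m + 2 by ring]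
      refine le_of_mul_le_mul_right ?_ hx
      calc _ = (a n₀ * ((n₀ + 2 * m : ℕ) + 2 : ℝ) ^ (D + 1)) *
              (((n₀ + 2 * m : ℕ) : ℝ) + 4) ^ (D + 1) := by ring
        _ ≤ (a (n₀ + 2 * m) * ((n₀ : ℝ) + 2) ^ (D + 1)) *
              (((n₀ + 2 * m : ℕ) : ℝ) + 4) ^ (D + 1) := by gcongr
        _ = (a (n₀ + 2 * m) * (((n₀ + 2 * m : ℕ) : ℝ) + 4) ^ (D + 1)) *
              ((n₀ : ℝ) + 2) ^ (D + 1) := by ring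
        _ ≤ (a (n₀ + 2 * m + 2) * ((n₀ + 2 * m : ℕ) + 2 : ℝ) ^ (D + 1)) *
              ((n₀ : ℝ) + 2) ^ (D + 1) := by gcongr
        _ = _ := by ring
  have hbound : ∀ m : ℕ, a n₀ * ((n₀ + 2 * m : ℕ) + 2 : ℝ) ≤ C * ((n₀ : ℝ) + 2) ^ (D + 1) := by
    intro m
    have hx : (0 : ℝ) < ((n₀ + 2 * m : ℕ) + 2 : ℝ) ^ D := by positivity
    refine le_of_mul_le_mul_right ?_ hx
    calc _ = a n₀ * ((n₀ + 2 * m : ℕ) + 2 : ℝ) ^ (D + 1) := by ring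
      _ ≤ _ := hind m
      _ ≤ (C * ((n₀ + 2 * m : ℕ) + 2 : ℝ) ^ D) * ((n₀ : ℝ) + 2) ^ (D + 1) := by
        gcongr
        exact h _
      _ = _ := by ring
  obtain ⟨m, hm⟩ := exists_nat_gt (C * ((n₀ : ℝ) + 2) ^ (D + 1) / a n₀)
  rw [div_lt_iff₀ (ha n₀)] at hm
  have h1 := hbound m
  have h2 : (m : ℝ) ≤ ((n₀ + 2 * m : ℕ) + 2 : ℝ) := by
    push_cast
    linarith [m.cast_nonneg (α := ℝ), n₀.cast_nonneg (α := ℝ)]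
  have h3 := mul_le_mul_of_nonneg_left h2 (ha n₀).le
  linarith

namespace UnitaryRepresentation

variable {G : Type*} [Group G] {H : Type*} [NormedAddCommGroup H] [InnerProductSpace ℂ H]
  {π : UnitaryRepresentation G H} {b : G → H}

/-- The average of the operators `π g` over a finite set. -/
noncomputable def averageOp (π : UnitaryRepresentation G H) (X : Finset G) : H →ₗ[ℂ] H :=
  (X.card : ℂ)⁻¹ • ∑ g ∈ X, ((π g).toLinearEquiv : H →ₗ[ℂ] H)

theorem averageOp_apply (X : Finset G) (v : H) :
    π.averageOp X v = (X.card : ℂ)⁻¹ • ∑ g ∈ X, π g v := by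
  simp [averageOp]

theorem norm_averageOp_le (X : Finset G) (v : H) : ‖π.averageOp X v‖ ≤ ‖v‖ := by
  rw [averageOp_apply, norm_smul, norm_inv, Complex.norm_natCast]
  have h : ‖∑ g ∈ X, π g v‖ ≤ X.card * ‖v‖ := by
    simpa using norm_sum_le X fun g => π g v
  rcases X.eq_empty_or_nonempty with rfl | hX
  · simp
  · have hx : (0 : ℝ) < X.card := by exact_mod_cast hX.card_pos
    rw [inv_mul_le_iff₀ hx]
    exact h

/-- A mean ergodic theorem: averages over asymptotically right invariant sets tend to zero if there
are no nonzero invariant vectors. -/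
theorem tendsto_averageOp_zero [CompleteSpace H] {F : Set G} {X Y : ℕ → Finset G}
    (hX : ∀ i, (X i).Nonempty) (hXY : ∀ i, X i ⊆ Y i)
    (hF : ∀ i, ∀ h ∈ F, (X i).map (mulRightEmbedding h) ⊆ Y i)
    (hlim : Tendsto (fun i => (((Y i).card : ℝ) - (X i).card) / (X i).card) atTop (𝓝 0))
    (hfix : ∀ v, (∀ h ∈ F, π h v = v) → v = 0) (v : H) :
    Tendsto (fun i => π.averageOp (X i) v) atTop (𝓝 0) := by
  let E : Submodule ℂ H :=
    { carrier := {v | Tendsto (fun i => π.averageOp (X i) v) atTop (𝓝 0)}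
      add_mem' := fun {v w} hv hw => by
        simpa using Tendsto.add (f := fun i => π.averageOp (X i) v) hv hw
      zero_mem' := by simp
      smul_mem' := fun c v hv => by
        simpa using Tendsto.const_smul (f := fun i => π.averageOp (X i) v) hv c }
  have hE : ∀ h ∈ F, ∀ u, u - π h u ∈ E := by
    intro h hh u
    change Tendsto (fun i => π.averageOp (X i) (u - π h u)) atTop (𝓝 0)
    refine squeeze_zero_norm (a := fun i =>
      2 * (2 * ((((Y i).card : ℝ) - (X i).card) / (X i).card) * ‖u‖)) (fun i => ?_) ?_
    · have hf : ∀ y ∈ Y i, ‖π y u‖ ≤ ‖u‖ := fun y _ => (LinearIsometryEquiv.norm_map _ _).le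
      have h1 := norm_average_sub_average_le (hXY i) (hX i) hf
      have h2 := norm_average_sub_average_le (hF i h hh) ((hX i).map) hf
      rw [Finset.card_map, Finset.sum_map] at h2
      simp only [mulRightEmbedding_apply, map_mul_apply] at h2
      rw [map_sub, averageOp_apply, averageOp_apply]
      rw [norm_sub_rev] at h2
      refine (norm_sub_le_norm_sub_add_norm_sub _
        (((Y i).card : ℂ)⁻¹ • ∑ y ∈ Y i, π y u) _).trans ?_
      linarith
    · simpa using ((hlim.const_mul 2).mul_const ‖u‖).const_mul 2
  have hclosed : IsClosed (E : Set H) := by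
    refine isClosed_of_closure_subset fun v hv => ?_
    change Tendsto (fun i => π.averageOp (X i) v) atTop (𝓝 0)
    rw [Metric.tendsto_atTop]
    intro ε hε
    obtain ⟨w, hw, hvw⟩ := Metric.mem_closure_iff.1 hv (ε / 2) (half_pos hε)
    obtain ⟨n, hn⟩ := Metric.tendsto_atTop.1 (show Tendsto _ _ _ from hw) (ε / 2) (half_pos hε)
    refine ⟨n, fun i hi => ?_⟩
    have h1 := hn i hi
    rw [dist_zero_right] at h1 ⊢
    rw [dist_eq_norm] at hvw
    have h2 : π.averageOp (X i) v = π.averageOp (X i) (v - w) + π.averageOp (X i) w := by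
      rw [← map_add, sub_add_cancel]
    rw [h2]
    refine (norm_add_le _ _).trans_lt ?_
    linarith [π.norm_averageOp_le (X i) (v - w)]
  have hbot : Eᗮ = ⊥ := by
    rw [Submodule.eq_bot_iff]
    intro w hw
    refine hfix w fun h hh => ?_
    have h1 := (Submodule.mem_orthogonal' E w).1 hw _ (hE h hh w)
    rw [inner_sub_right, sub_eq_zero, inner_self_eq_norm_sq_to_K] at h1
    have h2 := norm_sub_sq (𝕜 := ℂ) w (π h w)
    rw [← h1, LinearIsometryEquiv.norm_map] at h2
    norm_cast at h2
    have h3 : ‖w - π h w‖ ^ 2 = 0 := by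
      rw [h2]
      ring
    exact (sub_eq_zero.1 (by simpa using h3)).symm
  have htop : E = ⊤ := by
    rw [← hclosed.submodule_topologicalClosure_eq]
    exact Submodule.topologicalClosure_eq_top_iff.2 hbot
  exact (htop ▸ Submodule.mem_top : v ∈ E)

end UnitaryRepresentation

namespace UnitaryRepresentation

variable {G : Type*} [Group G] {H : Type*} [NormedAddCommGroup H] [InnerProductSpace ℂ H]
  {π : UnitaryRepresentation G H} {b : G → H}

theorem eq_zero_of_fixed_mul_self [DecidableEq G] {S : Finset G}
    (hgen : Subgroup.closure (S : Set G) = ⊤) (hS : (1 : G) ∈ S ∨ S⁻¹ = S)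
    (hπ : ¬ π.HasFiniteSubrepresentation) {w : H} (hw : ∀ s ∈ S, ∀ t ∈ S, π (s * t) w = w) :
    w = 0 := by
  apply eq_zero_of_finiteIndex_vectorStabilizer hπ
  have htop : (∀ s ∈ S, π s w = w) → (π.vectorStabilizer w).FiniteIndex := by
    intro h
    have : π.vectorStabilizer w = ⊤ := by
      rw [eq_top_iff, ← hgen, Subgroup.closure_le]
      exact h
    rw [this]
    infer_instance
  rcases hS with h1 | hinv
  · exact htop fun s hs => by simpa using hw s hs 1 h1
  rcases S.eq_empty_or_nonempty with rfl | ⟨s, hs⟩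
  · exact htop (by simp)
  have h1 : ∀ t ∈ S, π t w = π s w := by
    intro t ht
    have hs' : s⁻¹ ∈ S := by
      rw [← hinv]
      exact Finset.inv_mem_inv hs
    have := hw _ hs' t ht
    rw [map_mul_apply] at this
    rw [← map_apply_inv_self (π := π) s (π t w), this]
  have h2 : ∀ g, (π g w = w ∧ π g (π s w) = π s w) ∨ (π g w = π s w ∧ π g (π s w) = w) := by
    intro g
    have hg : g ∈ Subgroup.closure (S : Set G) := hgen ▸ Subgroup.mem_top g
    induction hg using Subgroup.closure_induction with
    | mem t ht => exact Or.inr ⟨h1 t ht, by rw [← map_mul_apply, hw t ht s hs]⟩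
    | one => simp
    | mul g h _ _ ihg ihh =>
      rw [map_mul_apply, map_mul_apply]
      rcases ihg with ⟨a, c⟩ | ⟨a, c⟩ <;> rcases ihh with ⟨d, e⟩ | ⟨d, e⟩ <;>
        simp only [a, c, d, e, and_self, true_or, or_true]
    | inv g _ ih =>
      rcases ih with ⟨a, c⟩ | ⟨a, c⟩
      · refine Or.inl ⟨?_, ?_⟩
        · nth_rw 1 [← a, map_inv_apply_self]
        · nth_rw 1 [← c, map_inv_apply_self]
      · refine Or.inr ⟨?_, ?_⟩
        · nth_rw 1 [← c, map_inv_apply_self]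
        · nth_rw 1 [← a, map_inv_apply_self]
  let f : Bool → G ⧸ π.vectorStabilizer w := fun x => ((if x then 1 else s : G) : G ⧸ _)
  have hf : Function.Surjective f := by
    intro q
    obtain ⟨g, rfl⟩ := QuotientGroup.mk_surjective q
    rcases h2 g with ⟨h, -⟩ | ⟨h, -⟩
    · refine ⟨true, QuotientGroup.eq.2 ?_⟩
      simpa using h
    · refine ⟨false, QuotientGroup.eq.2 ?_⟩
      simp [map_mul_apply, h, map_inv_apply_self, -map_mul, -map_inv]
  have : Finite (G ⧸ π.vectorStabilizer w) := Finite.of_surjective f hf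
  exact Subgroup.finiteIndex_of_finite_quotient

theorem IsCocycle.affineAction_powAverage [DecidableEq G] (hb : π.IsCocycle b) (s : G)
    {S : Finset G} {n : ℕ} (hn : (S ^ n).Nonempty) :
    π.affineAction b s (powAverage S b n) =
      (((S ^ n).map (mulLeftEmbedding s)).card : ℂ)⁻¹ •
        ∑ g ∈ (S ^ n).map (mulLeftEmbedding s), b g := by
  have hc : ((S ^ n).card : ℂ) ≠ 0 := by exact_mod_cast hn.card_pos.ne'
  rw [Finset.card_map, Finset.sum_map]
  simp only [mulLeftEmbedding_apply, hb s, Finset.sum_add_distrib, Finset.sum_const, smul_add,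
    affineAction, powAverage, map_smul, map_sum]
  rw [← Nat.cast_smul_eq_nsmul ℂ, smul_smul, inv_mul_cancel₀ hc, one_smul]

theorem IsCocycle.average_map_mulRight (hb : π.IsCocycle b) (s : G) (X : Finset G) :
    ((X.map (mulRightEmbedding s)).card : ℂ)⁻¹ • ∑ g ∈ X.map (mulRightEmbedding s), b g =
      (X.card : ℂ)⁻¹ • ∑ g ∈ X, b g + π.averageOp X (b s) := by
  rw [Finset.card_map, Finset.sum_map, averageOp_apply]
  simp only [mulRightEmbedding_apply, hb _ s, Finset.sum_add_distrib, smul_add]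
  rw [add_comm]

end UnitaryRepresentation

theorem mainTheorem9 {G : Type*} [Group G] [DecidableEq G]
    (hG : Group.IsVirtuallyNilpotent G)
    (S : Finset G) (hgen : Subgroup.closure (S : Set G) = ⊤) (hS : (1 : G) ∈ S ∨ S⁻¹ = S)
    {H : Type*} [NormedAddCommGroup H] [InnerProductSpace ℂ H] [CompleteSpace H]
    (π : UnitaryRepresentation G H) (hπ : ¬ π.HasFiniteSubrepresentation)
    (b : G → H) (hb : π.IsCocycle b) :
    ∃ φ : ℕ → ℕ, StrictMono φ ∧
      π.IsAlmostFixedSeq b S (fun i => powAverage S b (φ i)) := by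
  rcases S.eq_empty_or_nonempty with rfl | hne
  · exact ⟨id, strictMono_id, fun s hs => by simp at hs⟩
  have h1 : (1 : G) ∈ S ^ 2 := by
    rw [pow_two]
    rcases hS with h | h
    · simpa using Finset.mul_mem_mul h h
    · obtain ⟨s, hs⟩ := hne
      have hs' : s⁻¹ ∈ S := by
        rw [← h]
        exact Finset.inv_mem_inv hs
      simpa using Finset.mul_mem_mul hs hs'
  have hsub : ∀ n, S ^ n ⊆ S ^ (n + 2) := fun n g hg => by
    rw [pow_add]
    simpa using Finset.mul_mem_mul hg h1
  have hmono : ∀ n, (S ^ n).card ≤ (S ^ (n + 1)).card := fun n => by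
    rw [pow_succ]
    exact Finset.card_le_card_mul_right hne
  have hpos : ∀ n, (0 : ℝ) < (S ^ n).card := fun n => by exact_mod_cast (hne.pow).card_pos
  obtain ⟨C, D, hCD⟩ := hG.exists_card_pow_le S
  obtain ⟨K, hK0, hK⟩ := frequently_mul_sub_le_of_le_mul_pow (a := fun n => ((S ^ n).card : ℝ))
    hpos (C := C) (D := D) (fun n => by exact_mod_cast hCD n)
  obtain ⟨φ, hφ, hφK⟩ := extraction_of_frequently_atTop hK
  have hgap : ∀ i, (((S ^ (φ i + 2)).card : ℝ) - (S ^ φ i).card) / (S ^ φ i).card ≤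
      K / ((φ i : ℝ) + 2) := fun i => by
    rw [div_le_div_iff₀ (hpos _) (by positivity)]
    linarith [hφK i]
  have hφlim : Tendsto (fun i => (φ i : ℝ) + 2) atTop atTop :=
    tendsto_atTop_add_const_right _ _ (tendsto_natCast_atTop_atTop.comp hφ.tendsto_atTop)
  have hKlim : Tendsto (fun i => K / ((φ i : ℝ) + 2)) atTop (𝓝 0) :=
    hφlim.const_div_atTop K
  have hgaplim : Tendsto (fun i => (((S ^ (φ i + 2)).card : ℝ) - (S ^ φ i).card) /
      (S ^ φ i).card) atTop (𝓝 0) := by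
    refine squeeze_zero (fun i => div_nonneg (sub_nonneg.2 ?_) (hpos _).le) hgap hKlim
    exact_mod_cast Finset.card_le_card (hsub _)
  have herg : ∀ v, Tendsto (fun i => π.averageOp (S ^ φ i) v) atTop (𝓝 0) := by
    refine UnitaryRepresentation.tendsto_averageOp_zero (F := ((S * S : Finset G) : Set G))
      (Y := fun i => S ^ (φ i + 2)) (fun i => hne.pow) (fun i => hsub _) ?_ hgaplim ?_
    · intro i h hh g hg
      obtain ⟨x, hx, rfl⟩ := Finset.mem_map.1 hg
      rw [pow_add, pow_two]
      exact Finset.mul_mem_mul hx hh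
    · intro v hv
      exact UnitaryRepresentation.eq_zero_of_fixed_mul_self hgen hS hπ
        fun s hs t ht => hv _ (Finset.mul_mem_mul hs ht)
  -- any translate of `S ^ n` inside `S ^ (n + 1)` has nearly the same average as `S ^ (n + 1)`
  have hclose : ∀ ε > 0, ∃ M : ℝ, 0 ≤ M ∧ ∀ i, ∀ X ⊆ S ^ (φ i + 1), X.card = (S ^ φ i).card →
      ‖(X.card : ℂ)⁻¹ • ∑ x ∈ X, b x - powAverage S b (φ i + 1)‖ ≤
        2 * (K * ε) + 2 * (K / ((φ i : ℝ) + 2) * M) := by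
    intro ε hε
    obtain ⟨M, hM0, hM⟩ := hb.sublinear hG S hgen hπ hε
    refine ⟨M, hM0, fun i X hX hcard => ?_⟩
    have hXne : X.Nonempty := by
      rw [← Finset.card_pos, hcard]
      exact hne.pow.card_pos
    refine (norm_average_sub_average_le hX hXne (hM (φ i + 1))).trans ?_
    have h2 : (((S ^ (φ i + 1)).card : ℝ) - X.card) / X.card ≤ K / ((φ i : ℝ) + 2) := by
      refine le_trans ?_ (hgap i)
      rw [hcard]
      have h3 : ((S ^ (φ i + 1)).card : ℝ) ≤ (S ^ (φ i + 2)).card := by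
        exact_mod_cast hmono (φ i + 1)
      have := hpos (φ i)
      gcongr
    have hx : (0 : ℝ) < (φ i : ℝ) + 2 := by positivity
    calc _ ≤ 2 * (K / ((φ i : ℝ) + 2)) * (ε * (φ i + 1 : ℕ) + M) := by gcongr
      _ ≤ 2 * (K / ((φ i : ℝ) + 2)) * (ε * ((φ i : ℝ) + 2) + M) := by
        gcongr
        push_cast
        linarith
      _ = _ := by
        field_simp
  refine ⟨φ, hφ, fun s hs => ?_⟩
  rw [Metric.tendsto_atTop]
  intro δ hδ
  obtain ⟨M, hM0, hM⟩ := hclose (δ / (8 * (K + 1))) (by positivity)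
  have hε : 2 * (K * (δ / (8 * (K + 1)))) ≤ δ / 4 := by
    have : K * (δ / (8 * (K + 1))) = δ / 8 * (K / (K + 1)) := by
      field_simp
    rw [this]
    have : K / (K + 1) ≤ 1 := by
      rw [div_le_one (by positivity)]
      linarith
    nlinarith
  have hlim : Tendsto (fun i => 4 * (K / ((φ i : ℝ) + 2) * M) +
      ‖π.averageOp (S ^ φ i) (b s)‖) atTop (𝓝 0) := by
    simpa using ((hKlim.mul_const M).const_mul 4).add (herg (b s)).norm
  obtain ⟨i₀, hi₀⟩ := eventually_atTop.1 (hlim.eventually (gt_mem_nhds (half_pos hδ)))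
  refine ⟨i₀, fun i hi => ?_⟩
  have hL := hM i ((S ^ φ i).map (mulLeftEmbedding s)) (fun g hg => by
    obtain ⟨x, hx, rfl⟩ := Finset.mem_map.1 hg
    rw [pow_succ']
    exact Finset.mul_mem_mul hs hx) (Finset.card_map _)
  have hR := hM i ((S ^ φ i).map (mulRightEmbedding s)) (fun g hg => by
    obtain ⟨x, hx, rfl⟩ := Finset.mem_map.1 hg
    rw [pow_succ]
    exact Finset.mul_mem_mul hx hs) (Finset.card_map _)
  rw [← hb.affineAction_powAverage s hne.pow] at hL
  rw [hb.average_map_mulRight] at hR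
  change ‖powAverage S b (φ i) + _ - _‖ ≤ _ at hR
  have hfin := hi₀ i hi
  rw [dist_zero_right, norm_norm]
  have e : π.affineAction b s (powAverage S b (φ i)) - powAverage S b (φ i) =
      (π.affineAction b s (powAverage S b (φ i)) - powAverage S b (φ i + 1)) -
        (powAverage S b (φ i) + π.averageOp (S ^ φ i) (b s) - powAverage S b (φ i + 1)) +
        π.averageOp (S ^ φ i) (b s) := by abel
  have h3 := norm_add_le ((π.affineAction b s (powAverage S b (φ i)) - powAverage S b (φ i + 1)) -
    (powAverage S b (φ i) + π.averageOp (S ^ φ i) (b s) - powAverage S b (φ i + 1)))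
    (π.averageOp (S ^ φ i) (b s))
  have h4 := norm_sub_le (π.affineAction b s (powAverage S b (φ i)) - powAverage S b (φ i + 1))
    (powAverage S b (φ i) + π.averageOp (S ^ φ i) (b s) - powAverage S b (φ i + 1))
  rw [← e] at h3
  linarith
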